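/- Let $\Gamma$ be a finite simple graph with vertex set $V$, $n=|V|$, with $c$ connected components, and let $X\subseteq V$, $X^c=V\setminus X$. For a finite group $\mathfrak G$ of order $\gamma$ let $\mathfrak G\cdot\Gamma^{(X)}$ be the gain graph on $V$ that has, for each edge $e$ of $\Gamma$ and each $g\in\mathfrak G$, one edge parallel to $e$ with gain $g$ (in a fixed orientation of $e$; the opposite orientation has gain $g^{-1}$), and one half edge at each vertex of $X$. The frame matroid of a gain graph with vertex set $V$ is the matroid on its set $E$ of edges and half edges with rank function $\mathrm{rk}(S)=|V|-b(S)$, where $b(S)$ is the number of connected components of $(V,S)$ that contain no half edge and in which every circle has gain $1$. The signless Whitney number is $\bar w_i=(-1)^i w_i$, where the characteristic polynomial of the matroid is $\sum_{S\subseteq E}(-1)^{|S|}\lambda^{\mathrm{rk}(E)-\mathrm{rk}(S)}=\sum_{i=0}^{\mathrm{rk}(E)} w_i\lambda^{\mathrm{rk}(E)-i}$, and $w_i=0$ for $i>\mathrm{rk}(E)$. For an ordinary graph $\Gamma$, $\bar w_i(\Gamma)$ is that of $\Gamma$ with all gains equal to the identity of the trivial group (i.e. of the cycle matroid of $\Gamma$).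 Let $\zeta$ be the number of isolated vertices of $\Gamma$ that are not in $X$. A vertex set is stable if it contains no two adjacent vertices of $\Gamma$. Then for each $i=0,1,\dots,n-\zeta$ and every finite group $\mathfrak G$, $$\bar w_i(\mathfrak G\cdot\Gamma^{(X)})=\sum_{j=0}^{i}\gamma^j\sum_{k=0}^{i-j}(-1)^k\binom{n-j-k}{n-i}\sum_{\substack{Y\subseteq X^c\text{ stable}\\ |Y|=k}}\bar w_j(\Gamma\setminus Y).$$ The right-hand side is a polynomial in $\gamma$, depending only on $\Gamma$, $X$ and $i$, of degree exactly $\min(i,n-c)$. Its leading term is $\bar w_i(\Gamma)\gamma^i$ if $i\le n-c$, and $\bar w_{n-c}(\Gamma)\binom{c-\zeta}{i-(n-c)}\gamma^{n-c}$ if $n-c\le i\le n-\zeta$. If $i>n-\zeta$, then $\bar w_i(\mathfrak G\cdot\Gamma^{(X)})=0$ for every finite group $\mathfrak G$. -/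

import Mathlib

open Polynomial

noncomputable section

/-- A gain graph on the vertex set `V` with gains in the group `G`. Its edges are the ordinary
edges `l : L` (links and loops) and the half edges `h : H`; a half edge has the single endpoint
`foot h`. An ordinary edge `l` is given with one of its two orientations, from `tail l` to
`head l`, and with the gain `gain l` in that orientation; the gain in the opposite orientation
is the inverse (see `GainGraph.ogain`). -/
structure GainGraph (V L H G : Type*) where
  tail : L → V
  head : L → V
  gain : L → G
  foot : H → V

namespace GainGraph

variable {V L H G : Type*}

/-- Initial vertex of an oriented edge: `(l, true)` is `l` in its given orientation, and
`(l, false)` is `l` with the opposite orientation. -/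
def src (Φ : GainGraph V L H G) (a : L × Bool) : V := if a.2 then Φ.tail a.1 else Φ.head a.1

/-- Final vertex of an oriented edge. -/
def tgt (Φ : GainGraph V L H G) (a : L × Bool) : V := if a.2 then Φ.head a.1 else Φ.tail a.1

/-- The gain of an oriented edge; reversing the orientation inverts it. -/
def ogain [Group G] (Φ : GainGraph V L H G) (a : L × Bool) : G :=
  if a.2 then Φ.gain a.1 else (Φ.gain a.1)⁻¹

/-- The adjacency relation of the spanning subgraph `(V, S)`, as a simple graph. It has the same
connected components as `(V, S)`. -/
def spanning (Φ : GainGraph V L H G) (S : Finset (L ⊕ H)) : SimpleGraph V :=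
  SimpleGraph.fromRel fun u v => ∃ l : L, Sum.inl l ∈ S ∧ Φ.tail l = u ∧ Φ.head l = v

/-- The list `p` of oriented edges runs once around a circle of `(V, S)`: each edge ends where
the next one (cyclically) begins, and no vertex and no edge is repeated. A loop is a circle of
length 1, and two parallel edges form a circle of length 2. -/
structure IsCircle (Φ : GainGraph V L H G) (S : Finset (L ⊕ H)) (p : List (L × Bool)) : Prop where
  ne_nil : p ≠ []
  mem : ∀ a ∈ p, Sum.inl a.1 ∈ S
  closed : p.map Φ.tgt = (p.map Φ.src).rotate 1
  nodup_vertices : (p.map Φ.src).Nodup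
  nodup_edges : (p.map Prod.fst).Nodup

/-- A component of the spanning subgraph `(V, S)` is balanced if it has no half edges and all its
circles are neutral, that is, have gain `1`. -/
def IsBalanced [Group G] (Φ : GainGraph V L H G) (S : Finset (L ⊕ H))
    (C : (Φ.spanning S).ConnectedComponent) : Prop :=
  (∀ h : H, Sum.inr h ∈ S → (Φ.spanning S).connectedComponentMk (Φ.foot h) ≠ C) ∧
  ∀ p : List (L × Bool), Φ.IsCircle S p →
    (∀ a ∈ p, (Φ.spanning S).connectedComponentMk (Φ.src a) = C) → (p.map Φ.ogain).prod = 1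

/-- `b(S)`, the number of balanced components of the spanning subgraph `(V, S)`. -/
def numBalanced [Group G] (Φ : GainGraph V L H G) (S : Finset (L ⊕ H)) : ℕ :=
  Nat.card {C : (Φ.spanning S).ConnectedComponent // Φ.IsBalanced S C}

/-- The rank function `rk(S) = |V| - b(S)` of the frame matroid of a gain graph. -/
def rank [Group G] (Φ : GainGraph V L H G) (S : Finset (L ⊕ H)) : ℕ :=
  Nat.card V - Φ.numBalanced S

end GainGraph

/-- The characteristic polynomial `∑_{S ⊆ E} (-1)^|S| λ^(rk E - rk S)` of the matroid on the
finite set `E` with rank function `r`. -/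
def matroidCharPoly {E : Type*} [Finite E] (r : Finset E → ℕ) : ℤ[X] :=
  letI := Fintype.ofFinite E
  ∑ S : Finset E, (-1) ^ S.card * X ^ (r Finset.univ - r S)

/-- The `i`-th Whitney number of the first kind `w_i` of the matroid on the finite set `E` with
rank function `r`: the coefficient of `λ^(rk E - i)` in the characteristic polynomial if
`i ≤ rk E`, and `0` if `i > rk E`. -/
def matroidWhitney {E : Type*} [Finite E] (r : Finset E → ℕ) (i : ℕ) : ℤ :=
  letI := Fintype.ofFinite E
  if i ≤ r Finset.univ then (matroidCharPoly r).coeff (r Finset.univ - i) else 0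

/-- The signless Whitney number `(-1)^i w_i` of (the frame matroid of) a finite gain graph. -/
def GainGraph.signlessWhitney {V L H G : Type*} [Group G] [Finite L] [Finite H]
    (Φ : GainGraph V L H G) (i : ℕ) : ℤ :=
  (-1) ^ i * matroidWhitney Φ.rank i

namespace SimpleGraph

variable {V : Type*}

/-- The partially filled `G`-expansion of `Γ`: an edge `(g, e)` for every `g : G` and every edge
`e` of `Γ`, having gain `g` in a fixed reference orientation of `e`, and a half edge at every
vertex in `X`. -/
def partialExpansion (G : Type*) (Γ : SimpleGraph V) (X : Finset V) :
    GainGraph V (G × Γ.edgeSet) X G where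
  tail l := (Quot.out (l.2 : Sym2 V)).1
  head l := (Quot.out (l.2 : Sym2 V)).2
  gain l := l.1
  foot h := h

/-- The graph `Γ` as a gain graph with identity gains from the trivial group; its frame matroid is
the cycle matroid of `Γ`. -/
def trivialGains (Γ : SimpleGraph V) : GainGraph V Γ.edgeSet Empty Unit where
  tail e := (Quot.out (e : Sym2 V)).1
  head e := (Quot.out (e : Sym2 V)).2
  gain _ := 1
  foot h := h.elim

/-- The signless Whitney number of (the cycle matroid of) the finite simple graph `Γ`. -/
def signlessWhitney [Finite V] (Γ : SimpleGraph V) (i : ℕ) : ℤ :=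
  Γ.trivialGains.signlessWhitney i

/-- The graph `Γ ∖ Y`, obtained by deleting the vertices in `Y`. -/
abbrev deleteVertices (Γ : SimpleGraph V) (Y : Finset V) : SimpleGraph {v : V // v ∉ Y} :=
  Γ.induce {v : V | v ∉ Y}

open Classical in
/-- The stable sets `Y` of `Γ` with `Y ⊆ Xᶜ` and `|Y| = k`. -/
def stableSets [Fintype V] (Γ : SimpleGraph V) (X : Finset V) (k : ℕ) : Finset (Finset V) :=
  {Y : Finset V | (∀ y ∈ Y, y ∉ X) ∧ (∀ u ∈ Y, ∀ v ∈ Y, ¬ Γ.Adj u v) ∧ Y.card = k}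

/-- `c`, the number of connected components of `Γ`. -/
def numComponents (Γ : SimpleGraph V) : ℕ := Nat.card Γ.ConnectedComponent

/-- `ζ`, the number of isolated vertices of `Γ` that are not in `X`. -/
def numIsolatedOutside (Γ : SimpleGraph V) (X : Finset V) : ℕ :=
  Nat.card {v : V // v ∉ X ∧ ∀ w, ¬ Γ.Adj v w}

end SimpleGraph

end

/-!
Write `χ_Φ(λ) = ∑_S (-1)^|S| λ^b(S)` for the chromatic polynomial of a gain graph `Φ` with `n`
vertices. It is the characteristic polynomial of the frame matroid times `λ^b(E)`, so the signless
Whitney number `w̄_i` is `(-1)^i` times the coefficient of `λ^(n-i)` in `χ_Φ`, for all `i ≤ n`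
(`GainGraph.signlessWhitney_eq`).

The value of `χ_Φ` at `tγ + 1` counts the proper colorings with colors in `K × G`, `|K| = t`, and
one more color that the group fixes (`GainGraph.eval_chromaticPoly`). This is inclusion-exclusion
over the set of improper edges, since a coloring that is improper on all of `S` is a free choice of
the color of one vertex in each balanced component and is neutral elsewhere
(`GainGraph.card_improper`). That rests on the fact that all closed walks in a balanced component
are neutral, although balance speaks of circles only (`GainGraph.prod_ogain_eq_one_of_isWalk`).

In the expansion of `Γ` the edges over `uv` carry all gains, so a coloring is proper if and only if
its `K`-coordinates are different at adjacent vertices, where the neutral color counts as one more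
value, which is forbidden on `X`. Sorting by the set `Y` of neutral vertices, which is stable and
disjoint from `X`, yields
`χ(tγ + 1) = ∑_Y γ^(n - |Y|) χ_{Γ ∖ Y}(t)`, and this identity for infinitely many `t` is an identity
of polynomials (`SimpleGraph.chromaticPoly_partialExpansion`). Comparing coefficients gives the
formula (`SimpleGraph.signlessWhitney_partialExpansion`).

For the leading term, `w̄_j(Γ)` is positive for `j ≤ n - c` by deletion and contraction
(`SimpleGraph.signlessWhitney_nonneg_and_pos`). If `Y` is stable, then the rank of `Γ ∖ Y` is at
most `n - c`, with equality if and only if all vertices in `Y` are isolated in `Γ`; in that case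
`Γ ∖ Y` and `Γ` have the same Whitney numbers. So the powers of `γ` beyond `n - c` vanish, and the
coefficient of `γ^(n-c)` is `w̄_{n-c}(Γ)` times an alternating sum of products of binomial
coefficients, which is evaluated by `sum_neg_one_pow_mul_choose_mul_choose`. Finally, an isolated
vertex outside `X` is a balanced component of the expansion, so the rank is at most `n - ζ`.
-/

noncomputable section

/-! ### Walks and balance -/

/-- If a relation fails to hold pairwise along a list, it fails at two entries of the list, and the
list can be split at these. -/
theorem List.exists_split_of_not_pairwise {α : Type*} {r : α → α → Prop} {p : List α}
    (h : ¬ p.Pairwise r) :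
    ∃ a x b y c, p = a ++ x :: (b ++ y :: c) ∧ ¬ r x y := by
  induction p with
  | nil => simp at h
  | cons z p ih =>
    by_cases hp : p.Pairwise r
    · have : ∃ y ∈ p, ¬ r z y := by
        by_contra! hc
        exact h (List.pairwise_cons.2 ⟨hc, hp⟩)
      obtain ⟨y, hy, hr⟩ := this
      obtain ⟨b, c, rfl⟩ := List.append_of_mem hy
      exact ⟨[], z, b, y, c, rfl, hr⟩
    · obtain ⟨a, x, b, y, c, rfl, hr⟩ := ih hp
      exact ⟨z :: a, x, b, y, c, rfl, hr⟩

namespace GainGraph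

variable {V L H G : Type*}

/-- The list `p` of oriented edges is a walk from `u` to `v` in the spanning subgraph `(V, S)`.
Vertices and edges may be repeated. -/
def IsWalk (Φ : GainGraph V L H G) (S : Finset (L ⊕ H)) : V → List (L × Bool) → V → Prop
  | u, [], v => u = v
  | u, a :: p, v => Sum.inl a.1 ∈ S ∧ Φ.src a = u ∧ Φ.IsWalk S (Φ.tgt a) p v

section Walks

variable {Φ : GainGraph V L H G} {S : Finset (L ⊕ H)}

theorem isWalk_append {p q : List (L × Bool)} {u v : V} :
    Φ.IsWalk S u (p ++ q) v ↔ ∃ w, Φ.IsWalk S u p w ∧ Φ.IsWalk S w q v := by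
  induction p generalizing u with
  | nil => simp [IsWalk]
  | cons a p ih => simp [IsWalk, ih, and_assoc]

theorem isWalk_cons {a : L × Bool} {p : List (L × Bool)} {u v : V} :
    Φ.IsWalk S u (a :: p) v ↔ Sum.inl a.1 ∈ S ∧ Φ.src a = u ∧ Φ.IsWalk S (Φ.tgt a) p v :=
  Iff.rfl

/-- The recursive condition for a walk in terms of the vertex lists, as in the definition of a
circle. -/
theorem isWalk_iff {p : List (L × Bool)} {u v : V} :
    Φ.IsWalk S u p v ↔
      (∀ a ∈ p, Sum.inl a.1 ∈ S) ∧ u :: p.map Φ.tgt = p.map Φ.src ++ [v] := by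
  induction p generalizing u with
  | nil => simp [IsWalk]
  | cons a p ih =>
    simp only [isWalk_cons, ih, List.mem_cons, forall_eq_or_imp, List.map_cons, List.cons_append,
      List.cons.injEq]
    tauto

theorem IsCircle.exists_cons_isWalk {p : List (L × Bool)} (h : Φ.IsCircle S p) :
    ∃ a ∈ p, Φ.IsWalk S (Φ.src a) p (Φ.src a) := by
  cases p with
  | nil => exact absurd rfl h.ne_nil
  | cons a p =>
    refine ⟨a, by simp, isWalk_iff.2 ⟨h.mem, ?_⟩⟩
    have := h.closed
    simp only [List.map_cons, List.rotate_cons_succ, List.rotate_zero] at this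
    simp [this]

theorem isCircle_of_isWalk {p : List (L × Bool)} {u : V} (hw : Φ.IsWalk S u p u) (hne : p ≠ [])
    (hv : (p.map Φ.src).Nodup) (he : (p.map Prod.fst).Nodup) : Φ.IsCircle S p := by
  refine ⟨hne, (isWalk_iff.1 hw).1, ?_, hv, he⟩
  have := (isWalk_iff.1 hw).2
  cases p with
  | nil => exact absurd rfl hne
  | cons a p =>
    simp only [List.map_cons, List.cons_append, List.cons.injEq] at this
    simp [this.1, this.2]

theorem adj_spanning {u v : V} : (Φ.spanning S).Adj u v ↔
    u ≠ v ∧ ∃ a : L × Bool, Sum.inl a.1 ∈ S ∧ Φ.src a = u ∧ Φ.tgt a = v := by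
  simp only [spanning, SimpleGraph.fromRel_adj, Prod.exists, Bool.exists_bool, src, tgt]
  refine and_congr_right fun _ => ⟨?_, ?_⟩
  · rintro (⟨l, h⟩ | ⟨l, h⟩)
    · exact ⟨l, Or.inr (by simpa using h)⟩
    · exact ⟨l, Or.inl (by simpa [and_comm] using h)⟩
  · rintro ⟨l, h | h⟩
    · exact Or.inr ⟨l, by simpa [and_comm] using h⟩
    · exact Or.inl ⟨l, by simpa using h⟩

theorem spanning_mono (Φ : GainGraph V L H G) {S T : Finset (L ⊕ H)} (h : S ⊆ T) :
    Φ.spanning S ≤ Φ.spanning T := by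
  intro u v huv
  obtain ⟨hne, a, ha, h1⟩ := adj_spanning.1 huv
  exact adj_spanning.2 ⟨hne, a, h ha, h1⟩

theorem IsWalk.reachable {p : List (L × Bool)} {u v : V} (h : Φ.IsWalk S u p v) :
    (Φ.spanning S).Reachable u v := by
  induction p generalizing u with
  | nil => obtain rfl : u = v := h; rfl
  | cons a p ih =>
    obtain ⟨ha, rfl, h⟩ := h
    refine SimpleGraph.Reachable.trans ?_ (ih h)
    by_cases hne : Φ.src a = Φ.tgt a
    · rw [hne]
    · exact (adj_spanning.2 ⟨hne, a, ha, rfl, rfl⟩).reachable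

theorem exists_isWalk_of_reachable {u v : V} (h : (Φ.spanning S).Reachable u v) :
    ∃ p, Φ.IsWalk S u p v := by
  obtain ⟨w⟩ := h
  induction w with
  | nil => exact ⟨[], rfl⟩
  | cons hadj _ ih =>
    obtain ⟨p, hp⟩ := ih
    obtain ⟨-, a, ha, rfl, rfl⟩ := adj_spanning.1 hadj
    exact ⟨a :: p, ha, rfl, hp⟩

theorem src_not (a : L × Bool) : Φ.src (a.1, !a.2) = Φ.tgt a := by
  rcases a with ⟨l, _ | _⟩ <;> rfl

theorem tgt_not (a : L × Bool) : Φ.tgt (a.1, !a.2) = Φ.src a := by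
  rcases a with ⟨l, _ | _⟩ <;> rfl

theorem ogain_not [Group G] (a : L × Bool) : Φ.ogain (a.1, !a.2) = (Φ.ogain a)⁻¹ := by
  rcases a with ⟨l, _ | _⟩ <;> simp [ogain]

/-- If all circles in a component are neutral, so are all closed walks: a closed walk that is not
a circle either splits at a repeated vertex into two shorter closed walks, or it traverses some
edge in both directions and can be shortened by cancelling the two traversals. -/
theorem prod_ogain_eq_one_of_isWalk [Group G] {C : (Φ.spanning S).ConnectedComponent}
    (hC : ∀ p : List (L × Bool), Φ.IsCircle S p →
      (∀ a ∈ p, (Φ.spanning S).connectedComponentMk (Φ.src a) = C) → (p.map Φ.ogain).prod = 1)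
    {p : List (L × Bool)} {u : V} (hu : (Φ.spanning S).connectedComponentMk u = C)
    (hw : Φ.IsWalk S u p u) : (p.map Φ.ogain).prod = 1 := by
  induction hm : p.length using Nat.strong_induction_on generalizing p u with
  | _ m ih =>
  subst hm
  by_cases hnil : p = []
  · simp [hnil]
  by_cases hd : p.Pairwise fun x y => Φ.src x ≠ Φ.src y ∧ x.1 ≠ y.1
  · refine hC p (isCircle_of_isWalk hw hnil ?_ ?_) ?_
    · exact List.pairwise_map.2 (hd.imp fun h => h.1)
    · exact List.pairwise_map.2 (hd.imp fun h => h.2)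
    · intro a ha
      obtain ⟨b, c, rfl⟩ := List.append_of_mem ha
      obtain ⟨w, hb, -, rfl, -⟩ := isWalk_append.1 hw
      rw [← hu]
      exact SimpleGraph.ConnectedComponent.sound hb.reachable.symm
  · obtain ⟨a, x, b, y, c, rfl, hxy⟩ := List.exists_split_of_not_pairwise hd
    obtain ⟨w, ha, hw⟩ := isWalk_append.1 hw
    obtain ⟨hx, rfl, hxw⟩ := isWalk_cons.1 hw
    obtain ⟨w, hb, hc⟩ := isWalk_append.1 hxw
    obtain ⟨hy, rfl, hc'⟩ := isWalk_cons.1 hc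
    have hux : (Φ.spanning S).connectedComponentMk (Φ.src x) = C := by
      rw [← hu]
      exact SimpleGraph.ConnectedComponent.sound ha.reachable.symm
    by_cases hs : Φ.src x = Φ.src y
    -- a repeated vertex: `x :: b` and `a ++ y :: c` are closed walks
    · have h1 := ih (x :: b).length (by simp; omega) hux
        (isWalk_cons.2 ⟨hx, rfl, hs ▸ hb⟩) rfl
      have h2 := ih (a ++ y :: c).length (by simp) hu
        (isWalk_append.2 ⟨_, ha, hs ▸ hc⟩) rfl
      simp only [List.map_append, List.map_cons, List.prod_append, List.prod_cons] at h1 h2 ⊢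
      rw [← h2, ← mul_assoc (Φ.ogain x), h1, one_mul]
    -- an edge used in both directions: `b` and `a ++ c` are closed walks
    · have he : x.1 = y.1 := by tauto
      have hyx : y = (x.1, !x.2) := by
        have : x.2 ≠ y.2 := fun h => hs (by rw [Prod.ext he h])
        refine Prod.ext he.symm ?_
        simpa using (Bool.eq_not_of_ne this.symm)
      subst hyx
      rw [src_not] at hb
      rw [tgt_not] at hc'
      have hux' : (Φ.spanning S).connectedComponentMk (Φ.tgt x) = C := by
        rw [← hux]
        refine SimpleGraph.ConnectedComponent.sound (IsWalk.reachable (p := [(x.1, !x.2)]) ?_)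
        exact ⟨hy, src_not x, tgt_not x⟩
      have h1 := ih b.length (by simp; omega) hux' hb rfl
      have h2 := ih (a ++ c).length (by simp; omega) hu (isWalk_append.2 ⟨_, ha, hc'⟩) rfl
      simp only [List.map_append, List.map_cons, List.prod_append, List.prod_cons, h1, one_mul,
        ogain_not, mul_inv_cancel_left] at h2 ⊢
      exact h2

end Walks

/-! ### Colorings of a gain graph -/

/-- Right multiplication by `g` on colors: the color `none` is fixed, and `g` acts freely on the
colors `K × G` by multiplication on the second coordinate. -/
def shift {K : Type*} [Group G] (x : Option (K × G)) (g : G) : Option (K × G) :=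
  x.map fun q => (q.1, q.2 * g)

section Shift

variable {K : Type*} [Group G]

@[simp] theorem shift_none (g : G) : shift (none : Option (K × G)) g = none := rfl

@[simp] theorem shift_one (x : Option (K × G)) : shift x 1 = x := by
  cases x <;> simp [shift]

theorem shift_shift (x : Option (K × G)) (g h : G) : shift (shift x g) h = shift x (g * h) := by
  cases x <;> simp [shift, mul_assoc]

theorem shift_inj {x y : Option (K × G)} {g : G} : shift x g = shift y g ↔ x = y := by
  refine ⟨fun h => ?_, fun h => h ▸ rfl⟩
  simpa [shift_shift] using congrArg (shift · g⁻¹) h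

@[simp] theorem shift_eq_none {x : Option (K × G)} {g : G} : shift x g = none ↔ x = none := by
  cases x <;> simp [shift]

theorem eq_none_of_shift_eq_self {x : Option (K × G)} {g : G} (hg : g ≠ 1) (h : shift x g = x) :
    x = none := by
  cases x with
  | none => rfl
  | some q => exact absurd (congrArg Prod.snd (Option.some.inj h)) (by simpa using hg)

end Shift

/-- A coloring `f` with colors in `K × G` and a neutral color `none` is improper on a link or loop
if the edge carries the color of its tail to the color of its head, and on a half edge if its foot
has the neutral color. -/
def Improper {K : Type*} [Group G] (Φ : GainGraph V L H G) (f : V → Option (K × G)) :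
    L ⊕ H → Prop
  | Sum.inl l => f (Φ.head l) = shift (f (Φ.tail l)) (Φ.gain l)
  | Sum.inr h => f (Φ.foot h) = none

section Coloring

variable {K : Type*} [Group G] {Φ : GainGraph V L H G} {S : Finset (L ⊕ H)}

theorem improper_inl_iff {f : V → Option (K × G)} (a : L × Bool) :
    Φ.Improper f (Sum.inl a.1) ↔ f (Φ.tgt a) = shift (f (Φ.src a)) (Φ.ogain a) := by
  rcases a with ⟨l, _ | _⟩
  · simp only [Improper, tgt, src, ogain, Bool.false_eq_true, if_false]
    rw [← shift_inj (g := Φ.gain l) (x := f (Φ.tail l)), shift_shift, inv_mul_cancel, shift_one,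
      eq_comm]
  · rfl

theorem IsWalk.color_eq {f : V → Option (K × G)} (hf : ∀ e ∈ S, Φ.Improper f e)
    {p : List (L × Bool)} {u v : V} (hw : Φ.IsWalk S u p v) :
    f v = shift (f u) (p.map Φ.ogain).prod := by
  induction p generalizing u with
  | nil => obtain rfl : u = v := hw; simp
  | cons a p ih =>
    obtain ⟨ha, rfl, hw⟩ := hw
    rw [ih hw, (improper_inl_iff a).1 (hf _ ha), shift_shift, List.map_cons, List.prod_cons]

/-- A coloring that is improper on all of `S` is neutral on the unbalanced components. -/
theorem color_eq_none_of_not_isBalanced {f : V → Option (K × G)}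
    (hf : ∀ e ∈ S, Φ.Improper f e) {v : V}
    (hv : ¬ Φ.IsBalanced S ((Φ.spanning S).connectedComponentMk v)) : f v = none := by
  suffices ∃ u, (Φ.spanning S).Reachable u v ∧ f u = none by
    obtain ⟨u, huv, hu⟩ := this
    obtain ⟨p, hp⟩ := exists_isWalk_of_reachable huv
    rw [hp.color_eq hf, hu, shift_none]
  rw [IsBalanced, not_and_or] at hv
  push Not at hv
  rcases hv with ⟨h, hS, hC⟩ | ⟨p, hp, hC, hg⟩
  · exact ⟨Φ.foot h, SimpleGraph.ConnectedComponent.exact hC, hf _ hS⟩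
  · obtain ⟨a, ha, hw⟩ := hp.exists_cons_isWalk
    exact ⟨Φ.src a, SimpleGraph.ConnectedComponent.exact (hC a ha),
      eq_none_of_shift_eq_self hg (hw.color_eq hf).symm⟩

/-- A coloring that is improper on all of `S` amounts to an arbitrary choice of the color of one
vertex in each balanced component. -/
theorem card_improper [Finite V] [Finite K] [Finite G] (Φ : GainGraph V L H G)
    (S : Finset (L ⊕ H)) :
    Nat.card {f : V → Option (K × G) // ∀ e ∈ S, Φ.Improper f e} =
      (Nat.card K * Nat.card G + 1) ^ Φ.numBalanced S := by
  classical
  have hr : ∀ v : V, ∃ p, Φ.IsWalk S ((Φ.spanning S).connectedComponentMk v).out p v := fun v =>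
    exists_isWalk_of_reachable (SimpleGraph.ConnectedComponent.exact
      (Quot.out_eq ((Φ.spanning S).connectedComponentMk v)))
  choose path hpath using hr
  -- a potential: the gain of a walk from a chosen root of the component of `v` to `v`
  set θ : V → G := fun v => ((path v).map Φ.ogain).prod with hθ
  rw [numBalanced, ← Nat.card_prod, ← Finite.card_option, ← Nat.card_fun]
  refine Nat.card_congr (Equiv.ofBijective
    (fun f (C : {C // Φ.IsBalanced S C}) => f.1 C.1.out) ⟨?_, ?_⟩)
  · intro f f' hff
    refine Subtype.ext (funext fun v => ?_)
    by_cases hv : Φ.IsBalanced S ((Φ.spanning S).connectedComponentMk v)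
    · rw [(hpath v).color_eq f.2, (hpath v).color_eq f'.2]
      exact congrArg (shift · _) (congrFun hff ⟨_, hv⟩)
    · rw [color_eq_none_of_not_isBalanced f.2 hv, color_eq_none_of_not_isBalanced f'.2 hv]
  · intro φ
    have key : ∀ {u v p}, Φ.IsWalk S u p v →
        Φ.IsBalanced S ((Φ.spanning S).connectedComponentMk v) →
        θ v = θ u * (p.map Φ.ogain).prod := by
      intro u v p hp hv
      have huv : (Φ.spanning S).connectedComponentMk u = (Φ.spanning S).connectedComponentMk v :=
        SimpleGraph.ConnectedComponent.sound hp.reachable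
      obtain ⟨q, hq⟩ := exists_isWalk_of_reachable (hpath v).reachable.symm
      have h1 := prod_ogain_eq_one_of_isWalk hv.2 rfl (isWalk_append.2 ⟨_, hq, hpath v⟩)
      have h2 := prod_ogain_eq_one_of_isWalk hv.2 rfl
        (isWalk_append.2 ⟨_, hq, isWalk_append.2 ⟨_, huv ▸ hpath u, hp⟩⟩)
      rw [List.map_append, List.prod_append] at h1 h2
      rw [← h1, mul_left_cancel_iff, List.map_append, List.prod_append] at h2
      exact h2.symm
    let f : V → Option (K × G) := fun v =>
      if hv : Φ.IsBalanced S ((Φ.spanning S).connectedComponentMk v) then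
        shift (φ ⟨_, hv⟩) (θ v) else none
    have hf : ∀ e ∈ S, Φ.Improper f e := by
      rintro (l | h) he
      · have hw : Φ.IsWalk S (Φ.tail l) [(l, true)] (Φ.head l) := ⟨he, rfl, rfl⟩
        have huv : (Φ.spanning S).connectedComponentMk (Φ.tail l) =
          (Φ.spanning S).connectedComponentMk (Φ.head l) :=
          SimpleGraph.ConnectedComponent.sound hw.reachable
        simp only [Improper, f]
        by_cases hv : Φ.IsBalanced S ((Φ.spanning S).connectedComponentMk (Φ.head l))
        · rw [dif_pos hv, dif_pos (huv ▸ hv), shift_shift, key hw hv]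
          simp only [huv]
          simp [ogain]
        · rw [dif_neg hv, dif_neg (huv ▸ hv), shift_none]
      · exact dif_neg fun hb => hb.1 h he rfl
    refine ⟨⟨f, hf⟩, funext fun C => ?_⟩
    have hC : (Φ.spanning S).connectedComponentMk C.1.out = C.1 := Quot.out_eq _
    have hCb : Φ.IsBalanced S ((Φ.spanning S).connectedComponentMk C.1.out) := by
      rw [hC]; exact C.2
    have hθ1 : θ C.1.out = 1 :=
      prod_ogain_eq_one_of_isWalk hCb.2 rfl (by simpa only [hC] using hpath C.1.out)
    simp only [f]
    rw [dif_pos hCb, hθ1, shift_one]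
    exact congrArg φ (Subtype.ext hC)

end Coloring

/-! ### The chromatic polynomial of a gain graph -/

/-- The chromatic polynomial `∑_{S ⊆ E} (-1)^|S| λ^b(S)` of a gain graph. It is the characteristic
polynomial of the frame matroid multiplied by `λ^b(E)`. -/
def chromaticPoly [Group G] [Finite L] [Finite H] (Φ : GainGraph V L H G) : ℤ[X] :=
  letI := Fintype.ofFinite (L ⊕ H)
  ∑ S : Finset (L ⊕ H), (-1) ^ S.card * X ^ Φ.numBalanced S

variable [Group G]

/-- The chromatic polynomial counts proper colorings. -/
theorem eval_chromaticPoly [Finite V] [Finite L] [Finite H] [Finite G] (K : Type*) [Finite K]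
    (Φ : GainGraph V L H G) :
    Φ.chromaticPoly.eval ((Nat.card K * Nat.card G + 1 : ℕ) : ℤ) =
      Nat.card {f : V → Option (K × G) // ∀ e, ¬ Φ.Improper f e} := by
  classical
  let := Fintype.ofFinite (L ⊕ H)
  let := Fintype.ofFinite (V → Option (K × G))
  have h1 : ∀ S : Finset (L ⊕ H),
      ((Nat.card K * Nat.card G + 1 : ℕ) : ℤ) ^ Φ.numBalanced S =
        ∑ f : V → Option (K × G), if ∀ e ∈ S, Φ.Improper f e then 1 else 0 := by
    intro S
    rw [← Nat.cast_pow, ← card_improper (K := K) Φ S, Nat.card_eq_fintype_card,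
      Fintype.card_subtype, Finset.card_filter]
    push_cast
    rfl
  have h2 : ∀ f : V → Option (K × G),
      (∑ S : Finset (L ⊕ H), (-1 : ℤ) ^ S.card * if ∀ e ∈ S, Φ.Improper f e then 1 else 0) =
        if ∀ e, ¬ Φ.Improper f e then 1 else 0 := by
    intro f
    have := Finset.sum_powerset_neg_one_pow_card
      (x := (Finset.univ.filter fun e => Φ.Improper f e))
    simp only [Finset.filter_eq_empty_iff, Finset.mem_univ, forall_const] at this
    rw [← this, ← Finset.filter_subset_univ, Finset.sum_filter]
    refine Finset.sum_congr rfl fun S _ => ?_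
    simp [Finset.subset_iff]
  rw [chromaticPoly, eval_finsetSum]
  simp only [eval_mul, eval_pow, eval_neg, eval_one, eval_X, h1, Finset.mul_sum]
  rw [Finset.sum_comm]
  simp only [h2]
  rw [Nat.card_eq_fintype_card, Fintype.card_subtype, Finset.card_filter]
  push_cast
  rfl

theorem numBalanced_le [Finite V] (Φ : GainGraph V L H G) (S : Finset (L ⊕ H)) :
    Φ.numBalanced S ≤ Nat.card V :=
  (Finite.card_subtype_le _).trans (Nat.card_le_card_of_surjective _ Quot.mk_surjective)

/-- A balanced component of a larger edge set contains a balanced component of a smaller one. -/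
theorem numBalanced_anti [Finite V] (Φ : GainGraph V L H G) {S T : Finset (L ⊕ H)} (h : S ⊆ T) :
    Φ.numBalanced T ≤ Φ.numBalanced S := by
  have hout : ∀ C : (Φ.spanning T).ConnectedComponent,
      (Φ.spanning T).connectedComponentMk C.out = C := fun C => Quot.out_eq C
  have hmk : ∀ {u v : V}, (Φ.spanning S).connectedComponentMk u =
      (Φ.spanning S).connectedComponentMk v → (Φ.spanning T).connectedComponentMk u =
      (Φ.spanning T).connectedComponentMk v := fun huv =>
    SimpleGraph.ConnectedComponent.sound
      ((SimpleGraph.ConnectedComponent.exact huv).mono (Φ.spanning_mono h))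
  refine Nat.card_le_card_of_injective (fun C : {C // Φ.IsBalanced T C} =>
    (⟨(Φ.spanning S).connectedComponentMk C.1.out, ?_, ?_⟩ : {C // Φ.IsBalanced S C})) ?_
  · intro e he heq
    exact C.2.1 e (h he) ((hmk heq).trans (hout C.1))
  · intro p hp hpC
    exact C.2.2 p ⟨hp.ne_nil, fun a ha => h (hp.mem a ha), hp.closed, hp.nodup_vertices,
      hp.nodup_edges⟩ fun a ha => (hmk (hpC a ha)).trans (hout C.1)
  · intro C D hCD
    refine Subtype.ext ?_
    rw [← hout C.1, ← hout D.1]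
    exact hmk (congrArg Subtype.val hCD)

theorem natDegree_chromaticPoly_le [Finite V] [Finite L] [Finite H] (Φ : GainGraph V L H G) :
    Φ.chromaticPoly.natDegree ≤ Nat.card V := by
  refine natDegree_sum_le_of_forall_le _ _ fun S _ => ?_
  rw [show ((-1 : ℤ[X]) ^ S.card) = C ((-1) ^ S.card) by simp]
  exact (natDegree_C_mul_X_pow_le _ _).trans (Φ.numBalanced_le S)

/-- The signless Whitney numbers are, up to sign, the coefficients of the chromatic polynomial. -/
theorem signlessWhitney_eq [Finite V] [Finite L] [Finite H] (Φ : GainGraph V L H G) (i : ℕ) :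
    Φ.signlessWhitney i =
      if i ≤ Nat.card V then (-1) ^ i * Φ.chromaticPoly.coeff (Nat.card V - i) else 0 := by
  let := Fintype.ofFinite (L ⊕ H)
  have hb := Φ.numBalanced_le Finset.univ
  have hfac : Φ.chromaticPoly =
      matroidCharPoly Φ.rank * X ^ Φ.numBalanced Finset.univ := by
    rw [chromaticPoly, matroidCharPoly, Finset.sum_mul]
    refine Finset.sum_congr rfl fun S _ => ?_
    rw [mul_assoc, ← pow_add]
    congr 2
    have h1 := Φ.numBalanced_le S
    have h2 := Φ.numBalanced_anti (Finset.subset_univ S)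
    simp only [rank]
    omega
  have hr : Φ.rank Finset.univ = Nat.card V - Φ.numBalanced Finset.univ := rfl
  rw [signlessWhitney, matroidWhitney, hr, hfac, coeff_mul_X_pow']
  by_cases h1 : i ≤ Nat.card V - Φ.numBalanced Finset.univ
  · rw [if_pos h1, if_pos (by omega), if_pos (by omega), Nat.sub_right_comm]
  · rw [if_neg h1]
    split_ifs with h2 h3
    · omega
    · rfl
    · simp

end GainGraph

namespace SimpleGraph

variable {V : Type*}

/-! ### Proper colorings of expansions -/

/-- The chromatic polynomial of the finite simple graph `Γ`. -/
def chromaticPoly [Finite V] (Γ : SimpleGraph V) : ℤ[X] := Γ.trivialGains.chromaticPoly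

/-- A symmetric relation holds along all edges in their reference orientation if and only if it
holds for all pairs of adjacent vertices. -/
theorem forall_edgeSet_out_iff (Γ : SimpleGraph V) {R : V → V → Prop}
    (hR : ∀ u v, R u v → R v u) :
    (∀ e : Γ.edgeSet, R (Quot.out (e : Sym2 V)).1 (Quot.out (e : Sym2 V)).2) ↔
      ∀ u v, Γ.Adj u v → R u v := by
  have hout : ∀ e : Sym2 V, s((Quot.out e).1, (Quot.out e).2) = e := fun e => Quot.out_eq e
  constructor
  · intro h u v huv
    have h1 := h ⟨s(u, v), huv⟩
    rcases Sym2.eq_iff.1 (hout s(u, v)) with ⟨hu, hv⟩ | ⟨hu, hv⟩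
    · simpa only [hu, hv] using h1
    · exact hR _ _ (by simpa only [hu, hv] using h1)
  · intro h e
    refine h _ _ ?_
    rw [← mem_edgeSet, hout]
    exact e.2

/-- The edges with all gains in `G` that are parallel to an edge of `Γ` together force the
`K`-coordinates of the colors of its ends to be different. -/
theorem forall_not_improper_partialExpansion {K G : Type*} [Group G] {Γ : SimpleGraph V}
    {X : Finset V} {f : V → Option (K × G)} :
    (∀ e, ¬ (Γ.partialExpansion G X).Improper f e) ↔
      (∀ u v, Γ.Adj u v → (f u).map Prod.fst ≠ (f v).map Prod.fst) ∧ ∀ v ∈ X, f v ≠ none := by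
  rw [← Γ.forall_edgeSet_out_iff fun u v h => h.symm]
  simp only [Sum.forall, GainGraph.Improper, partialExpansion, Prod.forall, Subtype.forall]
  refine and_congr ?_ Iff.rfl
  rw [forall_comm]
  refine forall_congr' fun e => ?_
  rw [forall_comm]
  refine forall_congr' fun _ => ?_
  rcases f (Quot.out e).1 with _ | ⟨a, x⟩ <;> rcases f (Quot.out e).2 with _ | ⟨b, y⟩
  · simp
  · simp
  · simp [GainGraph.shift]
  · simp only [GainGraph.shift, Option.map_some, Option.some.injEq, Prod.mk.injEq, not_and, ne_eq]
    refine ⟨fun h hab => h (x⁻¹ * y) hab.symm (by simp), fun h g hab => absurd hab.symm h⟩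

theorem forall_not_improper_trivialGains {K : Type*} {Γ : SimpleGraph V}
    {f : V → Option (K × Unit)} :
    (∀ e, ¬ Γ.trivialGains.Improper f e) ↔ ∀ u v, Γ.Adj u v → f u ≠ f v := by
  rw [← Γ.forall_edgeSet_out_iff fun u v h => h.symm]
  simp only [Sum.forall, GainGraph.Improper, trivialGains, GainGraph.shift_one, IsEmpty.forall_iff,
    and_true, ne_eq, eq_comm]

/-- Two finite color sets of the same size have the same number of colorings. -/
theorem card_coloring_congr (Γ : SimpleGraph V) {K K' : Type*} (e : K ≃ K') :
    Nat.card (Γ.Coloring K) = Nat.card (Γ.Coloring K') :=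
  Nat.card_congr
    { toFun c := Coloring.mk (fun v => e (c v)) fun h => e.injective.ne (c.valid h)
      invFun c := Coloring.mk (fun v => e.symm (c v)) fun h => e.symm.injective.ne (c.valid h)
      left_inv c := by ext v; exact e.symm_apply_apply _
      right_inv c := by ext v; exact e.apply_symm_apply _ }

theorem card_coloring_eq (Γ : SimpleGraph V) (K : Type*) :
    Nat.card (Γ.Coloring K) = Nat.card {f : V → K // ∀ u v, Γ.Adj u v → f u ≠ f v} :=
  Nat.card_congr
    { toFun c := ⟨c, fun _ _ h => c.valid h⟩
      invFun f := Coloring.mk f.1 fun h => f.2 _ _ h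
      left_inv _ := rfl
      right_inv _ := rfl }

theorem eval_chromaticPoly [Finite V] (Γ : SimpleGraph V) (K : Type*) [Finite K] [Nonempty K] :
    Γ.chromaticPoly.eval (Nat.card K : ℤ) = Nat.card (Γ.Coloring K) := by
  -- one of the colors is played by the neutral color
  have hpos : 0 < Nat.card K := Nat.card_pos
  have hcard : Nat.card K = Nat.card (Option (Fin (Nat.card K - 1) × Unit)) := by
    rw [Finite.card_option, Nat.card_prod, Nat.card_fin]
    simp; omega
  have h := Γ.trivialGains.eval_chromaticPoly (Fin (Nat.card K - 1))
  simp only [forall_not_improper_trivialGains] at h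
  rw [← card_coloring_eq] at h
  have e := (Finite.equivFin K).trans ((finCongr hcard).trans (Finite.equivFin _).symm)
  rw [Γ.card_coloring_congr e, ← h, chromaticPoly, Nat.card_fin,
    Nat.card_unique (α := Unit), mul_one, Nat.sub_add_cancel hpos]

/-- A polynomial that counts the colorings for every positive number of colors is the chromatic
polynomial. -/
theorem chromaticPoly_eq_of_eval [Finite V] {Γ : SimpleGraph V} {P : ℤ[X]}
    (h : ∀ k : ℕ, (Nat.card (Γ.Coloring (Fin (k + 1))) : ℤ) = P.eval ((k + 1 : ℕ) : ℤ)) :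
    Γ.chromaticPoly = P := by
  refine eq_of_infinite_eval_eq _ _ (Set.infinite_of_injective_forall_mem
    (f := fun k : ℕ => ((k + 1 : ℕ) : ℤ)) (fun a b hab => by simpa using hab) fun k => ?_)
  have := Γ.eval_chromaticPoly (Fin (k + 1))
  rw [Nat.card_fin] at this
  exact this.trans (h k)

theorem mem_stableSets [Fintype V] {Γ : SimpleGraph V} {X Y : Finset V} {k : ℕ} :
    Y ∈ Γ.stableSets X k ↔
      (∀ y ∈ Y, y ∉ X) ∧ (∀ u ∈ Y, ∀ v ∈ Y, ¬ Γ.Adj u v) ∧ Y.card = k := by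
  simp [stableSets]

open Classical in
/-- Proper colorings of the expansion, sorted by the set `Y` of vertices with neutral color. -/
theorem card_proper_partialExpansion [Fintype V] (Γ : SimpleGraph V) (X : Finset V)
    (K G : Type*) [Finite K] [Group G] [Finite G] :
    Nat.card {f : V → Option (K × G) // ∀ e, ¬ (Γ.partialExpansion G X).Improper f e} =
      ∑ k ∈ Finset.range (Fintype.card V + 1), ∑ Y ∈ Γ.stableSets X k,
        Nat.card G ^ (Fintype.card V - k) * Nat.card ((Γ.deleteVertices Y).Coloring K) := by
  let := Fintype.ofFinite (V → Option (K × G))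
  simp only [forall_not_improper_partialExpansion]
  let neutral : (V → Option (K × G)) → Finset V := fun f => {v | f v = none}
  have hk : ∀ k, ∀ Y ∈ Γ.stableSets X k, Y.card = k := fun k Y hY => (mem_stableSets.1 hY).2.2
  have hsum : (∑ k ∈ Finset.range (Fintype.card V + 1), ∑ Y ∈ Γ.stableSets X k,
        Nat.card G ^ (Fintype.card V - k) * Nat.card ((Γ.deleteVertices Y).Coloring K)) =
      ∑ k ∈ Finset.range (Fintype.card V + 1), ∑ Y ∈ Γ.stableSets X k,
        Nat.card G ^ (Fintype.card V - Y.card) * Nat.card ((Γ.deleteVertices Y).Coloring K) :=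
    Finset.sum_congr rfl fun k _ => Finset.sum_congr rfl fun Y hY => by rw [hk k Y hY]
  rw [hsum]
  rw [Nat.card_eq_fintype_card, Fintype.card_subtype, ← Finset.sum_biUnion]
  · rw [Finset.card_eq_sum_card_fiberwise (f := neutral) (t :=
      (Finset.range (Fintype.card V + 1)).biUnion (Γ.stableSets X))]
    · refine Finset.sum_congr rfl fun Y hY => ?_
      obtain ⟨k, -, hY⟩ := Finset.mem_biUnion.1 hY
      obtain ⟨hYX, hYs, rfl⟩ := mem_stableSets.1 hY
      have hG : Nat.card G ^ (Fintype.card V - Y.card) = Nat.card ({v : V // v ∉ Y} → G) := by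
        rw [Nat.card_fun, Nat.card_eq_fintype_card (α := {v : V // v ∉ Y}),
          Fintype.card_subtype_compl, Fintype.card_coe]
      rw [hG, ← Nat.card_prod, ← Fintype.card_coe, ← Nat.card_eq_fintype_card]
      symm
      -- the coloring with neutral set `Y` and given coordinates on the complement of `Y`
      let F : ({v : V // v ∉ Y} → G) × (Γ.deleteVertices Y).Coloring K → V → Option (K × G) :=
        fun p v => if h : v ∉ Y then some (p.2 ⟨v, h⟩, p.1 ⟨v, h⟩) else none
      have hF1 : ∀ p v (h : v ∉ Y), F p v = some (p.2 ⟨v, h⟩, p.1 ⟨v, h⟩) :=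
        fun p v h => dif_pos h
      have hF2 : ∀ p v, v ∈ Y → F p v = none := fun p v h => dif_neg (not_not.2 h)
      refine Nat.card_congr (Equiv.ofBijective (fun p => ⟨F p, ?_⟩) ⟨?_, ?_⟩)
      · simp only [Finset.mem_filter, Finset.mem_univ, true_and, neutral, Finset.ext_iff]
        refine ⟨⟨fun u v huv => ?_, fun v hv => ?_⟩, fun v => ?_⟩
        · by_cases hu : u ∈ Y
          · have hv : v ∉ Y := fun hv => hYs u hu v hv huv
            simp [hF2 p u hu, hF1 p v hv]
          · by_cases hv : v ∈ Y
            · simp [hF1 p u hu, hF2 p v hv]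
            · rw [hF1 p u hu, hF1 p v hv]
              have := p.2.valid (v := ⟨u, hu⟩) (w := ⟨v, hv⟩) huv
              simpa using this
        · rw [hF1 p v fun h => hYX v h hv]
          simp
        · by_cases hv : v ∈ Y
          · simp [hF2 p v hv, hv]
          · simp [hF1 p v hv, hv]
      · intro p q hpq
        have h : ∀ v : {v // v ∉ Y}, (p.2 v, p.1 v) = (q.2 v, q.1 v) := by
          intro v
          have := congrFun (congrArg Subtype.val hpq) v.1
          simpa only [hF1 _ v.1 v.2, Option.some.injEq] using this
        refine Prod.ext (funext fun v => congrArg Prod.snd (h v)) ?_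
        ext v
        exact congrArg Prod.fst (h v)
      · rintro ⟨f, hf⟩
        simp only [Finset.mem_filter, Finset.mem_univ, true_and, neutral, Finset.ext_iff] at hf
        obtain ⟨⟨hf1, hf2⟩, hf3⟩ := hf
        have hs : ∀ v : {v // v ∉ Y}, ∃ q, f v = some q := fun v =>
          Option.ne_none_iff_exists'.1 fun h => v.2 ((hf3 v).1 h)
        choose q hq using hs
        refine ⟨(fun v => (q v).2, Coloring.mk (fun v => (q v).1) fun {u v} huv h => ?_), ?_⟩
        · refine hf1 _ _ huv ?_
          change (f u).map Prod.fst = (f v).map Prod.fst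
          rw [hq u, hq v, Option.map_some, Option.map_some, h]
        · refine Subtype.ext (funext fun v => ?_)
          by_cases hv : v ∈ Y
          · exact (hF2 _ v hv).trans ((hf3 v).2 hv).symm
          · exact (hF1 _ v hv).trans (hq ⟨v, hv⟩).symm
    · intro f hf
      simp only [Finset.coe_filter, Finset.mem_univ, true_and, Set.mem_ofPred_eq] at hf
      refine Finset.mem_coe.2 (Finset.mem_biUnion.2 ⟨(neutral f).card, ?_, mem_stableSets.2
        ⟨fun y hy hyX => ?_, fun u hu v hv huv => ?_, rfl⟩⟩)
      · exact Finset.mem_range.2 (Nat.lt_succ_of_le (Finset.card_le_univ _))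
      · exact hf.2 y hyX (by simpa [neutral] using hy)
      · refine hf.1 u v huv ?_
        simp only [neutral, Finset.mem_filter, Finset.mem_univ, true_and] at hu hv
        rw [hu, hv]
  · intro k _ l _ hkl
    refine Finset.disjoint_left.2 fun Y h1 h2 => hkl ?_
    rw [← hk k Y h1, ← hk l Y h2]

/-! ### The Whitney numbers of an expansion -/

theorem signlessWhitney_eq [Finite V] (Γ : SimpleGraph V) (i : ℕ) :
    Γ.signlessWhitney i =
      if i ≤ Nat.card V then (-1) ^ i * Γ.chromaticPoly.coeff (Nat.card V - i) else 0 :=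
  GainGraph.signlessWhitney_eq _ i

theorem eval_chromaticPoly_eq_sum [Finite V] (Γ : SimpleGraph V) (x : ℤ) :
    Γ.chromaticPoly.eval x = ∑ j ∈ Finset.range (Nat.card V + 1),
      (-1) ^ j * Γ.signlessWhitney j * x ^ (Nat.card V - j) := by
  rw [eval_eq_sum_range' (p := Γ.chromaticPoly)
      (Nat.lt_succ_of_le (GainGraph.natDegree_chromaticPoly_le _)),
    ← Finset.sum_range_reflect]
  refine Finset.sum_congr rfl fun j hj => ?_
  have hj' : j ≤ Nat.card V := Nat.lt_succ_iff.1 (Finset.mem_range.1 hj)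
  rw [signlessWhitney_eq, if_pos hj', ← mul_assoc, ← mul_pow]
  simp [chromaticPoly]

theorem card_compl_of_mem_stableSets [Fintype V] {Γ : SimpleGraph V} {X Y : Finset V} {k : ℕ}
    (hY : Y ∈ Γ.stableSets X k) : Nat.card {v : V // v ∉ Y} = Fintype.card V - k := by
  classical
  rw [Nat.card_eq_fintype_card, Fintype.card_subtype_compl, Fintype.card_coe,
    (mem_stableSets.1 hY).2.2]

/-- The balanced expansion formula: with `x = tγ + 1` colors, of which one is neutral, the proper
colorings with neutral set `Y` are counted by `γ ^ |V ∖ Y|` times the chromatic polynomial of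
`Γ ∖ Y` at `t = (x - 1) / γ`. -/
theorem chromaticPoly_partialExpansion [Fintype V] (Γ : SimpleGraph V) (X : Finset V)
    (G : Type*) [Group G] [Finite G] :
    (Γ.partialExpansion G X).chromaticPoly =
      ∑ k ∈ Finset.range (Fintype.card V + 1), ∑ Y ∈ Γ.stableSets X k,
        ∑ j ∈ Finset.range (Fintype.card V - k + 1),
          C ((-1) ^ j * (Γ.deleteVertices Y).signlessWhitney j * (Nat.card G : ℤ) ^ j) *
            (Polynomial.X + C (-1)) ^ (Fintype.card V - k - j) := by
  have hγ : 0 < Nat.card G := Nat.card_pos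
  refine eq_of_infinite_eval_eq _ _ (Set.infinite_of_injective_forall_mem
    (f := fun t : ℕ => (((t + 1) * Nat.card G + 1 : ℕ) : ℤ)) (fun a b hab => ?_) fun t => ?_)
  · simpa [hγ.ne'] using hab
  · have h1 := (Γ.partialExpansion G X).eval_chromaticPoly (Fin (t + 1))
    rw [Nat.card_fin] at h1
    refine h1.trans ?_
    rw [card_proper_partialExpansion, eval_finsetSum]
    push_cast
    refine Finset.sum_congr rfl fun k _ => ?_
    rw [eval_finsetSum]
    refine Finset.sum_congr rfl fun Y hY => ?_
    have h2 := (Γ.deleteVertices Y).eval_chromaticPoly (Fin (t + 1))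
    rw [Nat.card_fin] at h2
    rw [← h2, eval_chromaticPoly_eq_sum, card_compl_of_mem_stableSets hY, eval_finsetSum,
      Finset.mul_sum]
    refine Finset.sum_congr rfl fun j hj => ?_
    have hj' : j ≤ Fintype.card V - k := Nat.lt_succ_iff.1 (Finset.mem_range.1 hj)
    obtain ⟨m, hm⟩ := Nat.exists_eq_add_of_le hj'
    rw [hm, Nat.add_sub_cancel_left]
    simp only [eval_mul, eval_C, eval_pow, eval_add, eval_X]
    push_cast
    rw [add_neg_cancel_right, mul_pow]
    ring

/-- Comparison of coefficients in the balanced expansion formula. -/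
theorem signlessWhitney_partialExpansion [Fintype V] (Γ : SimpleGraph V) (X : Finset V)
    (G : Type*) [Group G] [Finite G] {i : ℕ} (hi : i ≤ Fintype.card V) :
    (Γ.partialExpansion G X).signlessWhitney i =
      ∑ j ∈ Finset.range (i + 1), (∑ k ∈ Finset.range (i - j + 1),
        (-1) ^ k * ((Fintype.card V - j - k).choose (Fintype.card V - i) : ℤ) *
          ∑ Y ∈ Γ.stableSets X k, (Γ.deleteVertices Y).signlessWhitney j) *
        (Nat.card G : ℤ) ^ j := by
  rw [GainGraph.signlessWhitney_eq, Nat.card_eq_fintype_card, if_pos hi,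
    chromaticPoly_partialExpansion]
  simp only [finsetSum_coeff, coeff_C_mul, coeff_X_add_C_pow, Finset.mul_sum, Finset.sum_mul]
  set n := Fintype.card V
  rw [Finset.sum_congr rfl fun k _ => Finset.sum_comm,
    Finset.sum_sigma' (Finset.range (n + 1)) fun k => Finset.range (n - k + 1),
    Finset.sum_sigma' (Finset.range (i + 1)) fun j => Finset.range (i - j + 1)]
  symm
  refine Finset.sum_of_injOn (fun p => ⟨p.2, p.1⟩) ?_ ?_ ?_ ?_
  · rintro ⟨a, b⟩ _ ⟨c, d⟩ _ h
    simp only [Sigma.mk.injEq, heq_eq_eq] at h ⊢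
    exact h.symm
  · rintro ⟨j, k⟩ h
    simp only [Finset.coe_sigma, Set.mem_sigma_iff, Finset.mem_coe, Finset.mem_range] at h ⊢
    omega
  · rintro ⟨k, j⟩ h1 h2
    simp only [Finset.mem_sigma, Finset.mem_range, Set.mem_image, Finset.mem_coe, Sigma.exists,
      Sigma.mk.injEq, heq_eq_eq] at h1 h2
    have hij : ¬ (j < i + 1 ∧ k < i - j + 1) := fun h => h2 ⟨j, k, h, rfl, rfl⟩
    have hlt : n - k - j < n - i := by omega
    refine Finset.sum_eq_zero fun Y _ => ?_
    rw [Nat.choose_eq_zero_of_lt hlt]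
    simp
  · rintro ⟨j, k⟩ h
    simp only [Finset.mem_sigma, Finset.mem_range] at h
    refine Finset.sum_congr rfl fun Y _ => ?_
    have hsign : (-1 : ℤ) ^ i * ((-1) ^ j * (-1) ^ (n - k - j - (n - i))) = (-1) ^ k := by
      rw [← pow_add, ← pow_add, neg_one_pow_eq_pow_mod_two, neg_one_pow_eq_pow_mod_two k]
      congr 1
      omega
    rw [← hsign, Nat.sub_right_comm n j k]
    ring

/-! ### Numbers of components -/

/-- A surjective map of vertex sets that keeps adjacent vertices connected does not increase the
number of components. -/
theorem numComponents_le_of_map {W : Type*} [Finite V] {Γ : SimpleGraph V} {Γ' : SimpleGraph W}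
    (π : V → W) (hadj : ∀ x y, Γ.Adj x y → Γ'.Reachable (π x) (π y))
    (hπ : Function.Surjective π) : Γ'.numComponents ≤ Γ.numComponents := by
  have hreach : ∀ {x y}, Γ.Reachable x y → Γ'.Reachable (π x) (π y) := by
    rintro x y ⟨w⟩
    induction w with
    | nil => rfl
    | cons h _ ih => exact (hadj _ _ h).trans ih
  refine Nat.card_le_card_of_surjective
    (fun C : Γ.ConnectedComponent => Γ'.connectedComponentMk (π C.out)) fun D => ?_
  obtain ⟨v, hv⟩ := hπ D.out
  refine ⟨Γ.connectedComponentMk v, ?_⟩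
  have h : Γ.Reachable (Γ.connectedComponentMk v).out v :=
    ConnectedComponent.exact (Quot.out_eq (Γ.connectedComponentMk v))
  refine (ConnectedComponent.sound (hreach h)).trans ?_
  rw [hv]
  exact Quot.out_eq D

theorem numComponents_le_card [Finite V] (Γ : SimpleGraph V) : Γ.numComponents ≤ Nat.card V :=
  Nat.card_le_card_of_surjective _ Quot.mk_surjective

open Classical in
/-- Every component of `Γ` meets the complement of the stable set `Y` or is a single isolated
vertex in `Y`. -/
theorem numComponents_le_deleteVertices [Fintype V] (Γ : SimpleGraph V) {Y : Finset V}
    (hY : ∀ u ∈ Y, ∀ v ∈ Y, ¬ Γ.Adj u v) :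
    Γ.numComponents ≤
      (Γ.deleteVertices Y).numComponents + (Y.filter fun v => ∀ w, ¬ Γ.Adj v w).card := by
  rw [numComponents, numComponents, ← Fintype.card_coe, ← Nat.card_eq_fintype_card, ← Nat.card_sum]
  let F : (Γ.deleteVertices Y).ConnectedComponent ⊕ (Y.filter fun v => ∀ w, ¬ Γ.Adj v w) →
      Γ.ConnectedComponent :=
    Sum.elim (fun D => Γ.connectedComponentMk D.out) fun y => Γ.connectedComponentMk y
  have hF : ∀ v, v ∉ Y → ∃ D, F D = Γ.connectedComponentMk v := by
    intro v hv
    refine ⟨Sum.inl ((Γ.deleteVertices Y).connectedComponentMk ⟨v, hv⟩), ?_⟩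
    refine ConnectedComponent.sound ?_
    have h : (Γ.deleteVertices Y).Reachable
        ((Γ.deleteVertices Y).connectedComponentMk ⟨v, hv⟩).out ⟨v, hv⟩ :=
      ConnectedComponent.exact (Quot.out_eq _)
    exact h.map (Embedding.comap _ Γ).toHom
  refine Nat.card_le_card_of_surjective F fun C => ?_
  induction C using ConnectedComponent.ind with
  | h v =>
    by_cases hv : v ∈ Y
    · by_cases hi : ∀ w, ¬ Γ.Adj v w
      · exact ⟨Sum.inr ⟨v, Finset.mem_filter.2 ⟨hv, hi⟩⟩, rfl⟩
      · push Not at hi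
        obtain ⟨w, hw⟩ := hi
        rw [ConnectedComponent.sound hw.reachable]
        exact hF w fun hwY => hY v hv w hwY hw
    · exact hF v hv

/-! ### Deletion and contraction -/

open Classical in
/-- The map of vertex sets underlying the contraction of an edge `uv`: it sends `v` to `u`. -/
def contractMap {u v : V} (huv : u ≠ v) (x : V) : {x : V // x ≠ v} :=
  if h : x = v then ⟨u, huv⟩ else ⟨x, h⟩

/-- The contraction of an edge `uv` of `Γ`, without loops and multiple edges: `v` is removed, and
its neighbors become neighbors of `u`. -/
def contract (Γ : SimpleGraph V) {u v : V} (huv : u ≠ v) : SimpleGraph {x : V // x ≠ v} :=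
  fromRel fun a b => ∃ x y, Γ.Adj x y ∧ contractMap huv x = a ∧ contractMap huv y = b

section Contract

variable {Γ : SimpleGraph V} {u v : V} (huv : u ≠ v)

theorem contractMap_self : contractMap huv v = ⟨u, huv⟩ := dif_pos rfl

theorem contractMap_of_ne {x : V} (hx : x ≠ v) : contractMap huv x = ⟨x, hx⟩ := dif_neg hx

theorem eq_or_eq_of_contractMap_eq {x y : V} (h : contractMap huv x = contractMap huv y) :
    x = y ∨ s(x, y) = s(u, v) := by
  by_cases hx : x = v <;> by_cases hy : y = v
  · exact Or.inl (hx.trans hy.symm)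
  · subst hx
    rw [contractMap_self, contractMap_of_ne huv hy, Subtype.mk.injEq] at h
    exact Or.inr (by rw [h, Sym2.eq_swap])
  · subst hy
    rw [contractMap_self, contractMap_of_ne huv hx, Subtype.mk.injEq] at h
    exact Or.inr (by rw [h])
  · rw [contractMap_of_ne huv hx, contractMap_of_ne huv hy, Subtype.mk.injEq] at h
    exact Or.inl h

theorem numComponents_contract_le [Finite V] :
    (Γ.contract huv).numComponents ≤ Γ.numComponents := by
  refine numComponents_le_of_map (contractMap huv) (fun x y hxy => ?_)
    fun a => ⟨a, contractMap_of_ne huv a.2⟩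
  by_cases h : contractMap huv x = contractMap huv y
  · rw [h]
  · exact Adj.reachable ((fromRel_adj _ _ _).2 ⟨h, Or.inl ⟨x, y, hxy, rfl, rfl⟩⟩)

/-- A proper coloring of `Γ` without the edge `uv` is a proper coloring of `Γ` or, if `u` and `v`
have the same color, of the contraction. -/
theorem card_coloring_deleteEdges [Finite V] (hadj : Γ.Adj u v) (K : Type*) [Finite K] :
    Nat.card ((Γ.deleteEdges {s(u, v)}).Coloring K) =
      Nat.card (Γ.Coloring K) + Nat.card ((Γ.contract hadj.ne).Coloring K) := by
  classical
  have hne := hadj.ne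
  rw [add_comm, card_coloring_eq, card_coloring_eq Γ, card_coloring_eq (Γ.contract _),
    ← Nat.card_congr (Equiv.sumCompl fun f : {f : V → K // ∀ x y,
      (Γ.deleteEdges {s(u, v)}).Adj x y → f x ≠ f y} => f.1 u = f.1 v), Nat.card_sum]
  have hdel : ∀ {x y}, Γ.Adj x y → s(x, y) ≠ s(u, v) → (Γ.deleteEdges {s(u, v)}).Adj x y :=
    fun h1 h2 => deleteEdges_adj.2 ⟨h1, h2⟩
  congr 1
  · have hF1 : ∀ c : {f : {x : V // x ≠ v} → K // ∀ a b, (Γ.contract hne).Adj a b → f a ≠ f b},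
        ∀ x y, (Γ.deleteEdges {s(u, v)}).Adj x y →
          c.1 (contractMap hne x) ≠ c.1 (contractMap hne y) := by
      intro c x y hxy
      obtain ⟨hxy, he⟩ := deleteEdges_adj.1 hxy
      refine c.2 _ _ ((fromRel_adj _ _ _).2 ⟨fun h => ?_, Or.inl ⟨x, y, hxy, rfl, rfl⟩⟩)
      rcases eq_or_eq_of_contractMap_eq hne h with h | h
      · exact hxy.ne h
      · exact he h
    have hF2 : ∀ c : {x : V // x ≠ v} → K, c (contractMap hne u) = c (contractMap hne v) := by
      intro c
      rw [contractMap_self, contractMap_of_ne hne hne]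
    refine (Nat.card_congr (Equiv.ofBijective
      (fun c => ⟨⟨fun x => c.1 (contractMap hne x), hF1 c⟩, hF2 c.1⟩) ⟨?_, ?_⟩)).symm
    · intro c d hcd
      refine Subtype.ext (_root_.funext fun a => ?_)
      have := congrFun (congrArg (fun f => f.1.1) hcd) a.1
      simpa [contractMap_of_ne hne a.2] using this
    · rintro ⟨⟨f, hf⟩, hfuv⟩
      have hc : ∀ x, f (contractMap hne x) = f x := by
        intro x
        by_cases hx : x = v
        · rw [hx, contractMap_self]; exact hfuv
        · rw [contractMap_of_ne hne hx]
      have key : ∀ x y, Γ.Adj x y → contractMap hne x ≠ contractMap hne y → f x ≠ f y := by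
        intro x y hxy h
        refine hf x y (hdel hxy fun he => h ?_)
        rcases Sym2.eq_iff.1 he with ⟨rfl, rfl⟩ | ⟨rfl, rfl⟩ <;>
        rw [contractMap_self, contractMap_of_ne hne hne]
      refine ⟨⟨fun a => f a, fun a b hab => ?_⟩, ?_⟩
      · obtain ⟨hab, ⟨x, y, hxy, rfl, rfl⟩ | ⟨x, y, hxy, rfl, rfl⟩⟩ := (fromRel_adj _ _ _).1 hab
        · simpa only [hc] using key x y hxy hab
        · simpa only [hc] using (key x y hxy hab.symm).symm
      · exact Subtype.ext (Subtype.ext (_root_.funext hc))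
  · refine Nat.card_congr
      { toFun f := ⟨f.1.1, fun x y hxy => ?_⟩
        invFun f := ⟨⟨f.1, fun x y hxy => f.2 x y (deleteEdges_adj.1 hxy).1⟩, f.2 u v hadj⟩
        left_inv _ := rfl
        right_inv _ := rfl }
    by_cases he : s(x, y) = s(u, v)
    · rcases Sym2.eq_iff.1 he with ⟨rfl, rfl⟩ | ⟨rfl, rfl⟩
      · exact f.2
      · exact Ne.symm f.2
    · exact f.1.2 x y (hdel hxy he)

/-- Deletion and contraction. -/
theorem chromaticPoly_eq_sub [Finite V] (hadj : Γ.Adj u v) :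
    Γ.chromaticPoly =
      (Γ.deleteEdges {s(u, v)}).chromaticPoly - (Γ.contract hadj.ne).chromaticPoly := by
  refine chromaticPoly_eq_of_eval fun k => ?_
  have h1 := (Γ.deleteEdges {s(u, v)}).eval_chromaticPoly (Fin (k + 1))
  have h2 := (Γ.contract hadj.ne).eval_chromaticPoly (Fin (k + 1))
  rw [Nat.card_fin] at h1 h2
  rw [eval_sub, h1, h2, card_coloring_deleteEdges hadj]
  push_cast
  ring

end Contract

/-! ### Positivity of the Whitney numbers of a graph -/

theorem signlessWhitney_bot [Finite V] (i : ℕ) :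
    (⊥ : SimpleGraph V).signlessWhitney i = if i = 0 then 1 else 0 := by
  have h : (⊥ : SimpleGraph V).chromaticPoly = Polynomial.X ^ Nat.card V := by
    refine chromaticPoly_eq_of_eval fun k => ?_
    rw [card_coloring_eq]
    simp [Nat.card_congr (Equiv.subtypeUnivEquiv _), Nat.card_fun]
  rw [signlessWhitney_eq, h, coeff_X_pow]
  split_ifs <;> first | omega | simp_all

theorem card_ne_add_one [Finite V] (v : V) : Nat.card {x : V // x ≠ v} + 1 = Nat.card V := by
  classical
  have := Fintype.ofFinite V
  have hpos : 0 < Fintype.card V := Fintype.card_pos_iff.2 ⟨v⟩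
  rw [Nat.card_eq_fintype_card, Nat.card_eq_fintype_card, Fintype.card_subtype_compl]
  simp
  omega

theorem signlessWhitney_succ_eq_add [Finite V] {Γ : SimpleGraph V} {u v : V} (hadj : Γ.Adj u v)
    (i : ℕ) : Γ.signlessWhitney (i + 1) =
      (Γ.deleteEdges {s(u, v)}).signlessWhitney (i + 1) +
        (Γ.contract hadj.ne).signlessWhitney i := by
  have hcard := card_ne_add_one v
  simp only [signlessWhitney_eq]
  rw [chromaticPoly_eq_sub hadj, coeff_sub]
  by_cases hi : i + 1 ≤ Nat.card V
  · rw [if_pos hi, if_pos hi, if_pos (by omega),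
      show Nat.card {x : V // x ≠ v} - i = Nat.card V - (i + 1) by omega]
    ring
  · rw [if_neg hi, if_neg hi, if_neg (by omega), add_zero]

theorem signlessWhitney_zero_eq_of_adj [Finite V] {Γ : SimpleGraph V} {u v : V}
    (hadj : Γ.Adj u v) :
    Γ.signlessWhitney 0 = (Γ.deleteEdges {s(u, v)}).signlessWhitney 0 := by
  have hcard := card_ne_add_one v
  have hdeg := GainGraph.natDegree_chromaticPoly_le (Γ.contract hadj.ne).trivialGains
  simp only [signlessWhitney_eq]
  rw [chromaticPoly_eq_sub hadj, coeff_sub,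
    coeff_eq_zero_of_natDegree_lt (p := (Γ.contract hadj.ne).chromaticPoly)
      (lt_of_le_of_lt hdeg (by omega)), sub_zero]

/-- The signless Whitney numbers are nonnegative, and positive up to the rank, by deletion and
contraction. -/
theorem signlessWhitney_nonneg_and_pos [Finite V] (Γ : SimpleGraph V) :
    (∀ i, 0 ≤ Γ.signlessWhitney i) ∧
      ∀ i, i + Γ.numComponents ≤ Nat.card V → 0 < Γ.signlessWhitney i := by
  induction hn : Nat.card V using Nat.strong_induction_on generalizing V with
  | _ n ihV =>
  subst hn
  induction Γ using WellFoundedLT.induction with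
  | _ Γ ihΓ =>
  by_cases hΓ : Γ = ⊥
  · subst hΓ
    have hc : (⊥ : SimpleGraph V).numComponents = Nat.card V := by
      refine (Nat.card_congr (Equiv.ofBijective (⊥ : SimpleGraph V).connectedComponentMk
        ⟨fun u v huv => ?_, Quot.mk_surjective⟩)).symm
      simpa using ConnectedComponent.exact huv
    simp only [signlessWhitney_bot]
    exact ⟨fun i => by split_ifs <;> simp, fun i hi => by rw [if_pos (by omega)]; simp⟩
  · obtain ⟨u, v, hadj⟩ := ne_bot_iff_exists_adj.1 hΓ
    have hlt : Γ.deleteEdges {s(u, v)} < Γ :=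
      lt_of_le_of_ne (deleteEdges_le _) fun h => by
        have := h.symm ▸ hadj
        simp at this
    obtain ⟨hd1, hd2⟩ := ihΓ _ hlt
    have hcard := card_ne_add_one v
    obtain ⟨hc1, hc2⟩ := ihV _ (by omega) (Γ.contract hadj.ne) rfl
    have hcomp := numComponents_contract_le (Γ := Γ) hadj.ne
    refine ⟨fun i => ?_, fun i hi => ?_⟩
    · cases i with
      | zero => rw [signlessWhitney_zero_eq_of_adj hadj]; exact hd1 0
      | succ i => rw [signlessWhitney_succ_eq_add hadj]; exact add_nonneg (hd1 _) (hc1 _)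
    · cases i with
      | zero =>
        rw [signlessWhitney_zero_eq_of_adj hadj]
        exact hd2 0 (by rw [zero_add]; exact numComponents_le_card _)
      | succ i =>
        rw [signlessWhitney_succ_eq_add hadj]
        exact add_pos_of_nonneg_of_pos (hd1 _) (hc2 _ (by omega))

/-! ### Ranks -/

/-- The rank of the cycle matroid is `n - c`, so the Whitney numbers vanish beyond it. -/
theorem signlessWhitney_eq_zero_of_lt [Finite V] (Γ : SimpleGraph V) {j : ℕ}
    (hj : Nat.card V < j + Γ.numComponents) : Γ.signlessWhitney j = 0 := by
  let := Fintype.ofFinite (Γ.edgeSet ⊕ Empty)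
  have hb : ∀ C, Γ.trivialGains.IsBalanced Finset.univ C :=
    fun C => ⟨fun h => h.elim, fun _ _ _ => Subsingleton.elim _ _⟩
  have hs : Γ.trivialGains.spanning Finset.univ = Γ := by
    have hadj : ∀ e : Γ.edgeSet, Γ.Adj (Γ.trivialGains.tail e) (Γ.trivialGains.head e) :=
      (Γ.forall_edgeSet_out_iff fun _ _ h => h.symm).2 fun _ _ h => h
    refine le_antisymm (fun u v huv => ?_) ?_
    · obtain ⟨-, ⟨e, _ | _⟩, -, rfl, rfl⟩ := GainGraph.adj_spanning.1 huv
      · exact (hadj e).symm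
      · exact hadj e
    · exact (Γ.forall_edgeSet_out_iff fun _ _ h => h.symm).1 fun e =>
        GainGraph.adj_spanning.2 ⟨(hadj e).ne, (e, true), Finset.mem_univ _, rfl, rfl⟩
  have hrank : Γ.trivialGains.rank Finset.univ = Nat.card V - Γ.numComponents := by
    rw [GainGraph.rank, GainGraph.numBalanced, Nat.card_congr (Equiv.subtypeUnivEquiv hb), hs]
    rfl
  have hr : ¬ j ≤ Γ.trivialGains.rank Finset.univ := by
    have := Γ.numComponents_le_card
    omega
  rw [signlessWhitney, GainGraph.signlessWhitney, matroidWhitney, if_neg hr, mul_zero]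

/-- In the expansion, an isolated vertex outside `X` is a balanced component. -/
theorem numIsolatedOutside_le_numBalanced [Finite V] (Γ : SimpleGraph V) (X : Finset V)
    (G : Type*) [Group G] (S : Finset (G × Γ.edgeSet ⊕ X)) :
    Γ.numIsolatedOutside X ≤ (Γ.partialExpansion G X).numBalanced S := by
  set Φ := Γ.partialExpansion G X with hΦ
  have hadj : ∀ a, Γ.Adj (Φ.src a) (Φ.tgt a) := by
    have h := (Γ.forall_edgeSet_out_iff (R := Γ.Adj) fun _ _ h => h.symm).2 fun _ _ h => h
    rintro ⟨l, _ | _⟩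
    · exact (h l.2).symm
    · exact h l.2
  have hiso : ∀ {u v : V}, (∀ w, ¬ Γ.Adj v w) →
      (Φ.spanning S).connectedComponentMk u = (Φ.spanning S).connectedComponentMk v → u = v := by
    intro u v hv huv
    obtain ⟨p, hp⟩ := GainGraph.exists_isWalk_of_reachable (ConnectedComponent.exact huv.symm)
    cases p with
    | nil => exact Eq.symm hp
    | cons a p => exact absurd (hp.2.1 ▸ hadj a) (hv _)
  refine Nat.card_le_card_of_injective
    (fun v : {v : V // v ∉ X ∧ ∀ w, ¬ Γ.Adj v w} =>
      (⟨(Φ.spanning S).connectedComponentMk v, ?_, ?_⟩ : {C // Φ.IsBalanced S C})) ?_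
  · intro h _ hh
    exact v.2.1 (hiso v.2.2 hh ▸ h.2)
  · intro p hp hpv
    obtain ⟨a, ha⟩ := List.exists_mem_of_ne_nil p hp.ne_nil
    exact absurd (hiso v.2.2 (hpv a ha) ▸ hadj a) (v.2.2 _)
  · intro u v huv
    exact Subtype.ext (hiso v.2.2 (congrArg Subtype.val huv))

theorem signlessWhitney_partialExpansion_eq_zero [Finite V] (Γ : SimpleGraph V) (X : Finset V)
    (G : Type*) [Group G] [Finite G] {i : ℕ} (hi : Nat.card V - Γ.numIsolatedOutside X < i) :
    (Γ.partialExpansion G X).signlessWhitney i = 0 := by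
  let := Fintype.ofFinite (G × Γ.edgeSet ⊕ X)
  have h := Γ.numIsolatedOutside_le_numBalanced X G Finset.univ
  have hr : ¬ i ≤ (Γ.partialExpansion G X).rank Finset.univ := by
    rw [GainGraph.rank]
    omega
  rw [GainGraph.signlessWhitney, matroidWhitney, if_neg hr, mul_zero]

/-! ### Deletion of stable sets -/

open Classical in
/-- Deleting isolated vertices does not change the cycle matroid. -/
theorem signlessWhitney_deleteVertices_of_isolated [Fintype V] (Γ : SimpleGraph V)
    {Y : Finset V} (hY : ∀ v ∈ Y, ∀ w, ¬ Γ.Adj v w) (j : ℕ) :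
    (Γ.deleteVertices Y).signlessWhitney j = Γ.signlessWhitney j := by
  have hpoly : Γ.chromaticPoly = (Γ.deleteVertices Y).chromaticPoly * Polynomial.X ^ Y.card := by
    refine chromaticPoly_eq_of_eval fun k => ?_
    have h1 := (Γ.deleteVertices Y).eval_chromaticPoly (Fin (k + 1))
    rw [Nat.card_fin] at h1
    rw [eval_mul, h1, eval_pow, eval_X, ← Nat.cast_pow, ← Nat.cast_mul]
    have h2 : (k + 1) ^ Y.card = Nat.card (Y → Fin (k + 1)) := by
      rw [Nat.card_fun, Nat.card_fin, Nat.card_eq_fintype_card, Fintype.card_coe]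
    rw [h2, card_coloring_eq, card_coloring_eq, ← Nat.card_prod]
    congr 1
    refine Nat.card_congr
      { toFun f := (⟨fun v => f.1 v, fun _ _ h => f.2 _ _ h⟩, fun v => f.1 v)
        invFun p := ⟨fun v => if h : v ∈ Y then p.2 ⟨v, h⟩ else p.1.1 ⟨v, h⟩, fun u v huv => ?_⟩
        left_inv f := ?_
        right_inv p := ?_ }
    · have hu : u ∉ Y := fun hu => hY u hu v huv
      have hv : v ∉ Y := fun hv => hY v hv u huv.symm
      simp only [dif_neg hu, dif_neg hv]
      exact p.1.2 ⟨u, hu⟩ ⟨v, hv⟩ huv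
    · exact Subtype.ext (_root_.funext fun v => by simp)
    · exact Prod.ext (Subtype.ext (_root_.funext fun v => dif_neg v.2))
        (_root_.funext fun v => dif_pos v.2)
  have hcard : Nat.card {v : V // v ∉ Y} = Nat.card V - Y.card := by
    rw [Nat.card_eq_fintype_card, Nat.card_eq_fintype_card, Fintype.card_subtype_compl,
      Fintype.card_coe]
  have hle : Y.card ≤ Nat.card V := by
    rw [Nat.card_eq_fintype_card]; exact Finset.card_le_univ Y
  rw [signlessWhitney_eq, signlessWhitney_eq, hpoly, coeff_mul_X_pow', hcard]
  by_cases h1 : j ≤ Nat.card V - Y.card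
  · rw [if_pos h1, if_pos (by omega), if_pos (by omega), Nat.sub_right_comm]
  · rw [if_neg h1]
    split_ifs
    · omega
    · simp
    · rfl

theorem signlessWhitney_deleteVertices_eq_zero_of_lt [Fintype V] {Γ : SimpleGraph V}
    {X Y : Finset V} {j k : ℕ} (hY : Y ∈ Γ.stableSets X k)
    (hj : Fintype.card V - Γ.numComponents < j) :
    (Γ.deleteVertices Y).signlessWhitney j = 0 := by
  classical
  obtain ⟨-, hs, hk⟩ := mem_stableSets.1 hY
  have h1 := Γ.numComponents_le_deleteVertices hs
  have h2 := Finset.card_filter_le Y fun v => ∀ w, ¬ Γ.Adj v w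
  have h3 := card_compl_of_mem_stableSets hY
  have h4 := Finset.card_le_univ Y
  exact signlessWhitney_eq_zero_of_lt _ (by omega)

theorem signlessWhitney_deleteVertices_of_not_isolated [Fintype V] {Γ : SimpleGraph V}
    {X Y : Finset V} {k : ℕ} (hY : Y ∈ Γ.stableSets X k)
    (hi : ¬ ∀ v ∈ Y, ∀ w, ¬ Γ.Adj v w) :
    (Γ.deleteVertices Y).signlessWhitney (Fintype.card V - Γ.numComponents) = 0 := by
  classical
  obtain ⟨-, hs, hk⟩ := mem_stableSets.1 hY
  have h1 := Γ.numComponents_le_deleteVertices hs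
  have h2 : (Y.filter fun v => ∀ w, ¬ Γ.Adj v w).card < Y.card := by
    refine Finset.card_lt_card (Finset.filter_ssubset.2 ?_)
    push Not at hi ⊢
    exact hi
  have h3 := card_compl_of_mem_stableSets hY
  have h4 := Finset.card_le_univ Y
  exact signlessWhitney_eq_zero_of_lt _ (by omega)

/-- In the rank `n - c` of `Γ`, only the sets of isolated vertices contribute. -/
theorem sum_stableSets_signlessWhitney [Fintype V] (Γ : SimpleGraph V) (X : Finset V) (k : ℕ) :
    ∑ Y ∈ Γ.stableSets X k,
        (Γ.deleteVertices Y).signlessWhitney (Fintype.card V - Γ.numComponents) =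
      ((Γ.numIsolatedOutside X).choose k : ℤ) *
        Γ.signlessWhitney (Fintype.card V - Γ.numComponents) := by
  classical
  have hsub : (Finset.univ.filter fun v : V => v ∉ X ∧ ∀ w, ¬ Γ.Adj v w).powersetCard k ⊆
      Γ.stableSets X k := by
    intro Y hY
    obtain ⟨h1, h2⟩ := Finset.mem_powersetCard.1 hY
    have h3 : ∀ v ∈ Y, v ∉ X ∧ ∀ w, ¬ Γ.Adj v w := fun v hv => (Finset.mem_filter.1 (h1 hv)).2
    exact mem_stableSets.2 ⟨fun v hv => (h3 v hv).1, fun u hu v _ => (h3 u hu).2 v, h2⟩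
  rw [← Finset.sum_subset hsub]
  · rw [Finset.sum_congr rfl fun Y hY => Γ.signlessWhitney_deleteVertices_of_isolated (Y := Y) ?_ _]
    · rw [Finset.sum_const, Finset.card_powersetCard, nsmul_eq_mul, numIsolatedOutside,
        Nat.card_eq_fintype_card, Fintype.card_subtype]
    · intro v hv
      exact (Finset.mem_filter.1 ((Finset.mem_powersetCard.1 hY).1 hv)).2.2
  · intro Y hY hY'
    obtain ⟨hX, -, hk⟩ := mem_stableSets.1 hY
    refine signlessWhitney_deleteVertices_of_not_isolated hY fun h => hY' ?_
    refine Finset.mem_powersetCard.2 ⟨fun v hv => ?_, hk⟩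
    exact Finset.mem_filter.2 ⟨Finset.mem_univ v, hX v hv, h v hv⟩

theorem numIsolatedOutside_le_numComponents [Finite V] (Γ : SimpleGraph V) (X : Finset V) :
    Γ.numIsolatedOutside X ≤ Γ.numComponents := by
  refine Nat.card_le_card_of_injective
    (fun v : {v : V // v ∉ X ∧ ∀ w, ¬ Γ.Adj v w} => Γ.connectedComponentMk v) ?_
  intro u v huv
  have h : ∀ {a b : V}, Γ.Reachable a b → (∀ w, ¬ Γ.Adj a w) → a = b := by
    rintro a b ⟨w⟩ ha
    cases w with
    | nil => rfl
    | cons h _ => exact absurd h (ha _)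
  exact Subtype.ext (h (ConnectedComponent.exact huv) u.2.2)

end SimpleGraph

/-- For `c = m + r`, both sides are the coefficient of `x ^ r` in
`(1 + x) ^ (c - z) * ((1 + x) - 1) ^ z`, with the second factor expanded on the left. -/
theorem sum_neg_one_pow_mul_choose_mul_choose (z m r : ℕ) (hz : z ≤ r) :
    ∑ k ∈ Finset.range (m + 1), (-1 : ℤ) ^ k * ((m + r - k).choose r : ℤ) * (z.choose k : ℤ) =
      ((m + r - z).choose m : ℤ) := by
  induction z generalizing m with
  | zero =>
    rw [Finset.sum_range_succ']
    simp [Nat.choose_symm_add]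
  | succ z ih =>
    cases m with
    | zero => simp
    | succ m =>
      have h1 := ih (m + 1) (by omega)
      have h2 := ih m (by omega)
      rw [Finset.sum_range_succ'] at h1 ⊢
      have h3 : m + 1 + r - z = (m + 1 + r - (z + 1)) + 1 := by omega
      have h4 : m + 1 + r - (z + 1) = m + r - z := by omega
      rw [h3, Nat.choose_succ_succ, h4] at h1
      rw [h4]
      push_cast at h1
      have h5 : ∀ k, (-1 : ℤ) ^ (k + 1) * ((m + 1 + r - (k + 1)).choose r : ℤ) *
            ((z + 1).choose (k + 1) : ℤ) =
          (-1 : ℤ) ^ (k + 1) * ((m + 1 + r - (k + 1)).choose r : ℤ) * (z.choose (k + 1) : ℤ) -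
          (-1 : ℤ) ^ k * ((m + r - k).choose r : ℤ) * (z.choose k : ℤ) := by
        intro k
        rw [show m + 1 + r - (k + 1) = m + r - k by omega, Nat.choose_succ_succ]
        push_cast
        ring
      simp only [h5, Finset.sum_sub_distrib, h2]
      simp only [Nat.choose_zero_right, Nat.succ_eq_add_one] at h1 ⊢
      linarith

/-! ### The leading term -/

/-- The coefficient of `γ ^ j` in the polynomial that gives the `i`-th signless Whitney number of
the expansion of `Γ` by a group of order `γ`. -/
def SimpleGraph.expansionCoeff {V : Type*} [Fintype V] (Γ : SimpleGraph V) (X : Finset V)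
    (i j : ℕ) : ℤ :=
  ∑ k ∈ Finset.range (i - j + 1),
    (-1) ^ k * ((Fintype.card V - j - k).choose (Fintype.card V - i) : ℤ) *
      ∑ Y ∈ Γ.stableSets X k, (Γ.deleteVertices Y).signlessWhitney j

namespace SimpleGraph

variable {V : Type*} [Fintype V] (Γ : SimpleGraph V) (X : Finset V)

theorem expansionCoeff_eq_zero_of_lt {i j : ℕ} (hj : Fintype.card V - Γ.numComponents < j) :
    Γ.expansionCoeff X i j = 0 := by
  refine Finset.sum_eq_zero fun k _ => ?_
  rw [Finset.sum_eq_zero fun Y hY => signlessWhitney_deleteVertices_eq_zero_of_lt hY hj, mul_zero]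

theorem expansionCoeff_self (i : ℕ) : Γ.expansionCoeff X i i = Γ.signlessWhitney i := by
  have h : Γ.stableSets X 0 = {∅} := by
    ext Y
    simp only [mem_stableSets, Finset.card_eq_zero, Finset.mem_singleton]
    refine ⟨fun h => h.2.2, ?_⟩
    rintro rfl
    simp
  rw [expansionCoeff, Nat.sub_self, zero_add, Finset.sum_range_one, h, Finset.sum_singleton,
    signlessWhitney_deleteVertices_of_isolated Γ (by simp)]
  simp

theorem expansionCoeff_rank {i : ℕ} (hi : i ≤ Fintype.card V - Γ.numIsolatedOutside X)
    (hci : Fintype.card V - Γ.numComponents ≤ i) :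
    Γ.expansionCoeff X i (Fintype.card V - Γ.numComponents) =
      Γ.signlessWhitney (Fintype.card V - Γ.numComponents) *
        ((Γ.numComponents - Γ.numIsolatedOutside X).choose
          (i - (Fintype.card V - Γ.numComponents)) : ℤ) := by
  have h1 := Γ.numIsolatedOutside_le_numComponents X
  have h2 := Γ.numComponents_le_card
  rw [Nat.card_eq_fintype_card] at h2
  simp only [expansionCoeff, sum_stableSets_signlessWhitney]
  obtain ⟨m, hm⟩ := Nat.exists_eq_add_of_le hci
  have h3 := sum_neg_one_pow_mul_choose_mul_choose (Γ.numIsolatedOutside X) m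
    (Fintype.card V - i) (by omega)
  rw [show m + (Fintype.card V - i) = Γ.numComponents by omega] at h3
  rw [show i - (Fintype.card V - Γ.numComponents) = m by omega,
    show Fintype.card V - (Fintype.card V - Γ.numComponents) = Γ.numComponents by omega, ← h3,
    Finset.mul_sum]
  exact Finset.sum_congr rfl fun k _ => by ring

theorem expansionCoeff_min_ne_zero {i : ℕ}
    (hi : i ≤ Fintype.card V - Γ.numIsolatedOutside X) :
    Γ.expansionCoeff X i (min i (Fintype.card V - Γ.numComponents)) ≠ 0 := by
  have h1 := Γ.numIsolatedOutside_le_numComponents X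
  have h2 := Γ.numComponents_le_card
  have hpos := Γ.signlessWhitney_nonneg_and_pos.2
  rw [Nat.card_eq_fintype_card] at h2 hpos
  rcases le_total i (Fintype.card V - Γ.numComponents) with h | h
  · rw [min_eq_left h, expansionCoeff_self]
    exact (hpos i (by omega)).ne'
  · rw [min_eq_right h, expansionCoeff_rank Γ X hi h]
    refine mul_ne_zero (hpos _ (by omega)).ne' ?_
    exact_mod_cast (Nat.choose_pos (by omega)).ne'

end SimpleGraph

end

theorem theorem2 {V : Type*} [Fintype V] (Γ : SimpleGraph V) (X : Finset V)
    (n c ζ : ℕ) (hn : n = Fintype.card V) (hc : c = Γ.numComponents)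
    (hζ : ζ = Γ.numIsolatedOutside X) :
    (∀ i : ℕ, i ≤ n - ζ → ∃ P : Polynomial ℤ,
      P = ∑ j ∈ Finset.range (i + 1),
            Polynomial.C (∑ k ∈ Finset.range (i - j + 1),
              (-1) ^ k * ((n - j - k).choose (n - i) : ℤ) *
                ∑ Y ∈ Γ.stableSets X k, (Γ.deleteVertices Y).signlessWhitney j) *
            Polynomial.X ^ j ∧
      (∀ (G : Type*) [Group G] [Finite G],
        (Γ.partialExpansion G X).signlessWhitney i = P.eval (Nat.card G : ℤ)) ∧
      P.degree = (min i (n - c) : ℕ) ∧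
      (i ≤ n - c → P.leadingCoeff = Γ.signlessWhitney i) ∧
      (n - c ≤ i →
        P.leadingCoeff =
          Γ.signlessWhitney (n - c) * ((c - ζ).choose (i - (n - c)) : ℤ))) ∧
    (∀ i : ℕ, n - ζ < i → ∀ (G : Type*) [Group G] [Finite G],
      (Γ.partialExpansion G X).signlessWhitney i = 0) := by
  subst hn hc hζ
  refine ⟨fun i hi => ⟨_, rfl, fun G _ _ => ?_, ?_⟩, fun i hi G _ _ => ?_⟩
  · rw [Γ.signlessWhitney_partialExpansion X G (hi.trans (Nat.sub_le _ _)), eval_finsetSum]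
    simp only [eval_mul, eval_C, eval_pow, eval_X]
  · change (∑ j ∈ Finset.range (i + 1), C (Γ.expansionCoeff X i j) * Polynomial.X ^ j).degree = _ ∧
      (_ → (∑ j ∈ Finset.range (i + 1),
        C (Γ.expansionCoeff X i j) * Polynomial.X ^ j).leadingCoeff = _) ∧
      (_ → (∑ j ∈ Finset.range (i + 1),
        C (Γ.expansionCoeff X i j) * Polynomial.X ^ j).leadingCoeff = _)
    set P := ∑ j ∈ Finset.range (i + 1), C (Γ.expansionCoeff X i j) * Polynomial.X ^ j with hP
    have hcoeff : ∀ j, P.coeff j = if j < i + 1 then Γ.expansionCoeff X i j else 0 := by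
      intro j
      simp [hP, finsetSum_coeff, coeff_X_pow]
    have hdeg : P.degree = (min i (Fintype.card V - Γ.numComponents) : ℕ) := by
      refine degree_eq_of_le_of_coeff_ne_zero ((degree_le_iff_coeff_zero _ _).2 fun j hj => ?_) ?_
      · rw [hcoeff]
        split_ifs with h
        · refine Γ.expansionCoeff_eq_zero_of_lt X ?_
          have hj' := Nat.cast_lt.1 hj
          omega
        · rfl
      · rw [hcoeff, if_pos (by omega)]
        exact Γ.expansionCoeff_min_ne_zero X hi
    refine ⟨hdeg, fun h => ?_, fun h => ?_⟩
    · rw [leadingCoeff, natDegree_eq_of_degree_eq_some hdeg, hcoeff, if_pos (by omega),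
        min_eq_left h, Γ.expansionCoeff_self X]
    · rw [leadingCoeff, natDegree_eq_of_degree_eq_some hdeg, hcoeff, if_pos (by omega),
        min_eq_right h, Γ.expansionCoeff_rank X hi h]
  · refine Γ.signlessWhitney_partialExpansion_eq_zero X G ?_
    rwa [Nat.card_eq_fintype_card]
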